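/- Let $\Gamma$ be a group (with the discrete topology), $T$ an automorphism of $\Gamma$, and $H=\ell^2(\Gamma)$ with standard basis $(\delta_g)_{g\in\Gamma}$. Let $l$ be the left regular representation, $[l(g)f](h)=f(g^{-1}h)$, let $A$ be the group von Neumann algebra of $\Gamma$, i.e. the von Neumann algebra on $H$ generated by $\{l(g):g\in\Gamma\}$, let $\mu(a)=\langle\delta_1,a\delta_1\rangle$ be its canonical trace, and let $\mathbb{Z}$ act on $A$ by $n\mapsto\alpha^n$, where $\alpha(a)=UaU^*$ and $Uf=f\circ T^{-1}$. The W*-dynamical system $\mathbf{A}=(A,\alpha,\mu)$ is called the dual system of $T$. A factor of $\mathbf{A}$ is a system $(F,\alpha|_F,\mu|_F)$ where $F$ is a von Neumann subalgebra of $A$ (containing the unit of $A$) with $\alpha^n(F)=F$ for all $n\in\mathbb{Z}$; factors are ordered by inclusion of their algebras. Such a system is compact if for every $a\in F$ the orbit $\{\alpha^n(a):n\in\mathbb{Z}\}$ is totally bounded in $F$ with respect to the norm $\|b\|_\mu=\mu(b^*b)^{1/2}$. The biggest compact factor $\mathbf{A}^K$ of $\mathbf{A}$ is the greatest element of the set of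 compact factors of $\mathbf{A}$. The finite orbit factor of $\mathbf{A}$ is the factor whose algebra is the von Neumann algebra generated by $\{l(g):g\in E\}$, where $E$ is the subgroup of those $g\in\Gamma$ whose orbit $\{T^n g:n\in\mathbb{Z}\}$ is finite. **Proposition.** For every group $\Gamma$ and every automorphism $T$ of $\Gamma$, the finite orbit factor of the dual system $\mathbf{A}$ is exactly its biggest compact factor $\mathbf{A}^K$; that is, the finite orbit factor is compact, and every compact factor of $\mathbf{A}$ is contained in it. -/

import Mathlib

open scoped ComplexOrder

noncomputable section

namespace DualSystems

/-! ### von Neumann algebras generated by a set -/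

section Generated

variable {H : Type*} [NormedAddCommGroup H] [InnerProductSpace ℂ H] [CompleteSpace H]

/-- The von Neumann algebra generated by a set `s` of bounded operators: the bicommutant of
`s ∪ s*`. It is the smallest von Neumann algebra on `H` that contains `s`
(`subset_generatedVN`, `generatedVN_le`). -/
def generatedVN (s : Set (H →L[ℂ] H)) : VonNeumannAlgebra H where
  toStarSubalgebra := StarSubalgebra.centralizer ℂ (Set.centralizer (s ∪ star s))
  centralizer_centralizer' := by simp

theorem mem_generatedVN {s : Set (H →L[ℂ] H)} {a : H →L[ℂ] H} :
    a ∈ generatedVN s ↔ a ∈ Set.centralizer (Set.centralizer (s ∪ star s)) := by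
  have h : star (Set.centralizer (s ∪ star s)) = Set.centralizer (s ∪ star s) := by
    ext x
    constructor
    · intro hx
      simpa using Set.star_mem_centralizer hx
    · intro hx
      exact Set.star_mem_centralizer hx
  change a ∈ Set.centralizer (_ ∪ star _) ↔ _
  rw [h, Set.union_self]

theorem subset_generatedVN (s : Set (H →L[ℂ] H)) : s ⊆ generatedVN s := fun _ ha =>
  mem_generatedVN.2 (Set.subset_centralizer_centralizer (Or.inl ha))

theorem generatedVN_le {s : Set (H →L[ℂ] H)} {M : VonNeumannAlgebra H} (h : s ⊆ M) :
    generatedVN s ≤ M := by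
  intro a ha
  have h' : s ∪ star s ⊆ M := by
    rintro x (hx | hx)
    · exact h hx
    · simpa using star_mem (h hx : star x ∈ M)
  have := Set.centralizer_subset (Set.centralizer_subset h') (mem_generatedVN.1 ha)
  rwa [M.centralizer_centralizer] at this

end Generated

/-! ### W*-dynamical systems, factors, compactness -/

/-- A W*-dynamical system: an action `α` of a group `G` by `*`-automorphisms on a von Neumann
algebra `A`, here acting on a Hilbert space `H`, with an `α`-invariant faithful normal
state `μ`. -/
structure WStarSystem (H : Type*) [NormedAddCommGroup H] [InnerProductSpace ℂ H]
    [CompleteSpace H] (G : Type*) [Group G] where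
  /-- the von Neumann algebra `A` -/
  algebra : VonNeumannAlgebra H
  /-- the dynamics `α` -/
  action : G →* (algebra.toStarSubalgebra ≃⋆ₐ[ℂ] algebra.toStarSubalgebra)
  /-- the state `μ` -/
  state : algebra.toStarSubalgebra →ₗ[ℂ] ℂ
  state_one : state 1 = 1
  state_nonneg : ∀ a, 0 ≤ state (star a * a)
  state_faithful : ∀ a, state (star a * a) = 0 → a = 0
  /-- normality, in the form `μ = ∑ₙ ⟨xₙ, · xₙ⟩` with `∑ₙ ‖xₙ‖² < ∞` -/
  state_normal : ∃ x : ℕ → H, Summable (fun n => ‖x n‖ ^ 2) ∧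
    ∀ a : algebra.toStarSubalgebra,
      HasSum (fun n => inner ℂ (x n) ((a : H →L[ℂ] H) (x n))) (state a)
  state_invariant : ∀ g a, state (action g a) = state a

namespace WStarSystem

variable {H : Type*} [NormedAddCommGroup H] [InnerProductSpace ℂ H] [CompleteSpace H]
variable {G : Type*} [Group G]

/-- The seminorm `‖a‖_μ = μ(a* a)^{1/2}`, i.e. the norm of the image of `a` in the cyclic
(GNS) representation given by `μ`. -/
def stateNorm (S : WStarSystem H G) (a : S.algebra.toStarSubalgebra) : ℝ :=
  Real.sqrt (S.state (star a * a)).re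

/-- A system is compact if every orbit `{α_g(a) : g ∈ G}` is totally bounded
with respect to `‖·‖_μ`. -/
def IsCompact (S : WStarSystem H G) : Prop :=
  ∀ a : S.algebra.toStarSubalgebra, ∀ ε : ℝ, 0 < ε →
    ∃ t : Set S.algebra.toStarSubalgebra, t.Finite ∧
      ∀ g : G, ∃ b ∈ t, S.stateNorm (S.action g a - b) < ε

/-- A factor of `S`: a von Neumann subalgebra `F` of `A` with `α_g(F) = F` for all `g`.
Its dynamics and its state are the restrictions, see `Factor.toSystem`. -/
@[ext]
structure Factor (S : WStarSystem H G) where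
  /-- the von Neumann subalgebra `F` -/
  algebra : VonNeumannAlgebra H
  le : algebra ≤ S.algebra
  invariant : ∀ g : G, S.action g '' {a : S.algebra.toStarSubalgebra | (a : H →L[ℂ] H) ∈ algebra} =
    {a : S.algebra.toStarSubalgebra | (a : H →L[ℂ] H) ∈ algebra}

namespace Factor

variable {S : WStarSystem H G}

/-- Factors of `S` are ordered by inclusion of their algebras. -/
instance : PartialOrder S.Factor :=
  PartialOrder.lift Factor.algebra fun _ _ h => Factor.ext h

/-- The inclusion of `F` in `A`. -/
def incl (F : S.Factor) : F.algebra.toStarSubalgebra →⋆ₐ[ℂ] S.algebra.toStarSubalgebra :=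
  StarSubalgebra.inclusion (show F.algebra.toStarSubalgebra ≤ S.algebra.toStarSubalgebra from F.le)

theorem coe_incl (F : S.Factor) (a : F.algebra.toStarSubalgebra) :
    (F.incl a : H →L[ℂ] H) = a := rfl

theorem action_mem (F : S.Factor) (g : G) (a : F.algebra.toStarSubalgebra) :
    (S.action g (F.incl a) : H →L[ℂ] H) ∈ F.algebra.toStarSubalgebra :=
  (F.invariant g).subset (Set.mem_image_of_mem _ a.2)

/-- The dynamics of `A` restricted to `F`. -/
def restrictAction (F : S.Factor) :
    G →* (F.algebra.toStarSubalgebra ≃⋆ₐ[ℂ] F.algebra.toStarSubalgebra) where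
  toFun g :=
    { toFun := fun a => ⟨S.action g (F.incl a), F.action_mem g a⟩
      invFun := fun a => ⟨S.action g⁻¹ (F.incl a), F.action_mem g⁻¹ a⟩
      left_inv := fun a => Subtype.ext <| by
        change ((S.action g⁻¹ (S.action g (F.incl a)) : S.algebra.toStarSubalgebra) :
          H →L[ℂ] H) = a
        rw [← StarAlgEquiv.mul_apply, ← map_mul]
        simp [coe_incl]
      right_inv := fun a => Subtype.ext <| by
        change ((S.action g (S.action g⁻¹ (F.incl a)) : S.algebra.toStarSubalgebra) :
          H →L[ℂ] H) = a
        rw [← StarAlgEquiv.mul_apply, ← map_mul]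
        simp [coe_incl]
      map_mul' := fun a b => Subtype.ext <| by simp
      map_add' := fun a b => Subtype.ext <| by simp
      map_star' := fun a => Subtype.ext <| by simp [map_star]
      map_smul' := fun c a => Subtype.ext <| by simp }
  map_one' := by ext a; simp [coe_incl]
  map_mul' g h := by
    ext1 a
    refine Subtype.ext ?_
    change ((S.action (g * h) (F.incl a) : S.algebra.toStarSubalgebra) : H →L[ℂ] H) =
      S.action g (S.action h (F.incl a))
    rw [map_mul]
    rfl

theorem incl_restrictAction (F : S.Factor) (g : G) (a : F.algebra.toStarSubalgebra) :
    F.incl (F.restrictAction g a) = S.action g (F.incl a) := rfl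

/-- A factor as a W*-dynamical system `(F, α|_F, μ|_F)`. -/
def toSystem (F : S.Factor) : WStarSystem H G where
  algebra := F.algebra
  action := F.restrictAction
  state := S.state ∘ₗ F.incl.toAlgHom.toLinearMap
  state_one := by simpa using S.state_one
  state_nonneg a := S.state_nonneg (F.incl a)
  state_faithful a h := by
    have := S.state_faithful (F.incl a) h
    have h' : (F.incl a : H →L[ℂ] H) = 0 := by rw [this]; rfl
    exact Subtype.ext h'
  state_normal := by
    obtain ⟨x, hx, h⟩ := S.state_normal
    exact ⟨x, hx, fun a => h (F.incl a)⟩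
  state_invariant g a := by
    change S.state (F.incl (F.restrictAction g a)) = S.state (F.incl a)
    rw [incl_restrictAction, S.state_invariant]

end Factor

/-- `K` is the biggest compact factor of `S`: it is a compact factor, and every compact factor
of `S` is contained in it. -/
def IsBiggestCompactFactor (S : WStarSystem H G) (K : S.Factor) : Prop :=
  IsGreatest {F : S.Factor | F.toSystem.IsCompact} K

end WStarSystem

/-! ### The group von Neumann algebra and its dual systems -/

/-- The Hilbert space `ℓ²(Γ)`. -/
abbrev ell2 (Γ : Type*) : Type _ := lp (fun _ : Γ => ℂ) 2

section Perm

variable {Γ : Type*}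

open Classical in
/-- The standard basis vector `δ_g` of `ℓ²(Γ)`. -/
def basisVec (g : Γ) : ell2 Γ := lp.single 2 g 1

theorem inner_basisVec (g : Γ) : inner ℂ (basisVec g) (basisVec g) = (1 : ℂ) := by
  classical
  rw [inner_self_eq_norm_sq_to_K, basisVec, lp.norm_single (by norm_num)]
  simp

theorem memℓp_comp (e : Equiv.Perm Γ) (f : ell2 Γ) :
    Memℓp (fun h => f (e.symm h) : Γ → ℂ) 2 := by
  have hf := lp.memℓp f
  rw [memℓp_gen_iff (by norm_num)] at hf ⊢
  exact (e.symm.summable_iff (f := fun i => ‖f i‖ ^ (2 : ENNReal).toReal)).2 hf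

/-- The isometry `f ↦ f ∘ e⁻¹` of `ℓ²(Γ)` given by a permutation `e` of `Γ`. -/
def permIsometry (e : Equiv.Perm Γ) : ell2 Γ ≃ₗᵢ[ℂ] ell2 Γ where
  toFun f := ⟨fun h => f (e.symm h), memℓp_comp e f⟩
  invFun f := ⟨fun h => f (e h), memℓp_comp e.symm f⟩
  left_inv f := by ext h; simp
  right_inv f := by ext h; simp
  map_add' f f' := by ext h; rfl
  map_smul' c f := by ext h; rfl
  norm_map' f := by
    rw [lp.norm_eq_tsum_rpow (by norm_num), lp.norm_eq_tsum_rpow (by norm_num)]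
    congr 1
    exact e.symm.tsum_eq (fun i => ‖f i‖ ^ (2 : ENNReal).toReal)

/-- The unitary operator `f ↦ f ∘ e⁻¹` on `ℓ²(Γ)`, for a permutation `e` of `Γ`. -/
def permUnitary : Equiv.Perm Γ →* unitary (ell2 Γ →L[ℂ] ell2 Γ) where
  toFun e := Unitary.linearIsometryEquiv.symm (permIsometry e)
  map_one' := by
    rw [EmbeddingLike.map_eq_one_iff]
    ext f h
    rfl
  map_mul' e e' := by
    rw [← map_mul]
    congr 1

@[simp]
theorem permUnitary_apply (e : Equiv.Perm Γ) (f : ell2 Γ) (h : Γ) :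
    (permUnitary e : ell2 Γ →L[ℂ] ell2 Γ) f h = f (e.symm h) := rfl

theorem permUnitary_basisVec (e : Equiv.Perm Γ) (g : Γ) :
    (permUnitary e : ell2 Γ →L[ℂ] ell2 Γ) (basisVec g) = basisVec (e g) := by
  classical
  ext h
  rw [permUnitary_apply]
  simp [basisVec, Pi.single_apply, Equiv.symm_apply_eq]

theorem star_permUnitary (e : Equiv.Perm Γ) :
    star (permUnitary e : ell2 Γ →L[ℂ] ell2 Γ) = permUnitary e⁻¹ := by
  rw [map_inv]; rfl

end Perm

section Dual

variable {Γ : Type*} [Group Γ]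

/-- The left regular representation: `[l(g) f](h) = f(g⁻¹ h)`. -/
def leftReg (g : Γ) : ell2 Γ →L[ℂ] ell2 Γ := permUnitary (Equiv.mulLeft g)

theorem leftReg_apply (g : Γ) (f : ell2 Γ) (h : Γ) : leftReg g f h = f (g⁻¹ * h) := rfl

variable (Γ) in
/-- The group von Neumann algebra of `Γ`, generated by `{l(g) : g ∈ Γ}`. -/
def groupVN : VonNeumannAlgebra (ell2 Γ) := generatedVN (Set.range leftReg)

/-- The unitary operator `U f = f ∘ T⁻¹` on `ℓ²(Γ)`. -/
def autUnitary (T : Γ ≃* Γ) : unitary (ell2 Γ →L[ℂ] ell2 Γ) := permUnitary T.toEquiv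

theorem autUnitary_apply (T : Γ ≃* Γ) (f : ell2 Γ) (h : Γ) :
    (autUnitary T : ell2 Γ →L[ℂ] ell2 Γ) f h = f (T.symm h) := rfl

theorem conj_leftReg (T : Γ ≃* Γ) (g : Γ) :
    Unitary.conjStarAlgAut ℂ _ (autUnitary T) (leftReg g) = leftReg (T g) := by
  rw [Unitary.conjStarAlgAut_apply]
  have h : star (autUnitary T : ell2 Γ →L[ℂ] ell2 Γ) = permUnitary T.toEquiv⁻¹ :=
    star_permUnitary _
  rw [h]
  ext f k
  change f (T.symm.symm (g⁻¹ * T.symm k)) = f ((T g)⁻¹ * k)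
  simp

theorem conj_mem_generatedVN {H : Type*} [NormedAddCommGroup H] [InnerProductSpace ℂ H]
    [CompleteSpace H] {s : Set (H →L[ℂ] H)} (φ : (H →L[ℂ] H) ≃⋆ₐ[ℂ] (H →L[ℂ] H))
    (hs : ∀ x ∈ s, φ x ∈ s) {a : H →L[ℂ] H} (ha : a ∈ generatedVN s) :
    φ a ∈ generatedVN s := by
  rw [mem_generatedVN] at ha ⊢
  intro c hc
  have hc' : φ.symm c ∈ Set.centralizer (s ∪ star s) := by
    rintro x hx
    have hx' : φ x ∈ s ∪ star s := by
      rcases hx with hx | hx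
      · exact Or.inl (hs x hx)
      · refine Or.inr ?_
        have h1 : φ (star x) = star (φ x) := φ.map_star' x
        rw [Set.mem_star, ← h1]
        exact hs _ hx
    have := congrArg φ.symm (hc _ hx')
    simpa using this
  have := congrArg φ (ha _ hc')
  simpa using this

theorem autUnitary_mul (S T : MulAut Γ) : autUnitary (S * T) = autUnitary S * autUnitary T :=
  map_mul permUnitary S.toEquiv T.toEquiv

theorem autUnitary_one : autUnitary (1 : MulAut Γ) = 1 := map_one permUnitary

theorem conj_mem_groupVN (T : Γ ≃* Γ) {a : ell2 Γ →L[ℂ] ell2 Γ} (ha : a ∈ groupVN Γ) :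
    Unitary.conjStarAlgAut ℂ _ (autUnitary T) a ∈ groupVN Γ := by
  refine conj_mem_generatedVN _ ?_ ha
  rintro _ ⟨g, rfl⟩
  exact ⟨T g, (conj_leftReg T g).symm⟩

/-- The `*`-automorphism `α(a) = U a U*` of the group von Neumann algebra, where `U f = f ∘ T⁻¹`
(as a homomorphism in the automorphism `T` of `Γ`). -/
def dualAut : MulAut Γ →*
    ((groupVN Γ).toStarSubalgebra ≃⋆ₐ[ℂ] (groupVN Γ).toStarSubalgebra) where
  toFun T :=
    { toFun := fun a => ⟨Unitary.conjStarAlgAut ℂ _ (autUnitary T) a, conj_mem_groupVN T a.2⟩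
      invFun := fun a =>
        ⟨Unitary.conjStarAlgAut ℂ _ (autUnitary T⁻¹) a, conj_mem_groupVN T⁻¹ a.2⟩
      left_inv := fun a => Subtype.ext <| by
        change Unitary.conjStarAlgAut ℂ _ (autUnitary T⁻¹)
          (Unitary.conjStarAlgAut ℂ _ (autUnitary T) (a : ell2 Γ →L[ℂ] ell2 Γ)) = a
        rw [← Unitary.conjStarAlgAut_mul_apply, ← autUnitary_mul, inv_mul_cancel, autUnitary_one,
          map_one, StarAlgEquiv.one_apply]
      right_inv := fun a => Subtype.ext <| by
        change Unitary.conjStarAlgAut ℂ _ (autUnitary T)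
          (Unitary.conjStarAlgAut ℂ _ (autUnitary T⁻¹) (a : ell2 Γ →L[ℂ] ell2 Γ)) = a
        rw [← Unitary.conjStarAlgAut_mul_apply, ← autUnitary_mul, mul_inv_cancel, autUnitary_one,
          map_one, StarAlgEquiv.one_apply]
      map_mul' := fun a b => Subtype.ext (map_mul (Unitary.conjStarAlgAut ℂ _ (autUnitary T))
        (a : ell2 Γ →L[ℂ] ell2 Γ) b)
      map_add' := fun a b => Subtype.ext (map_add (Unitary.conjStarAlgAut ℂ _ (autUnitary T))
        (a : ell2 Γ →L[ℂ] ell2 Γ) b)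
      map_star' := fun a => Subtype.ext (map_star (Unitary.conjStarAlgAut ℂ _ (autUnitary T))
        (a : ell2 Γ →L[ℂ] ell2 Γ))
      map_smul' := fun c a => Subtype.ext (map_smul (Unitary.conjStarAlgAut ℂ _ (autUnitary T))
        c (a : ell2 Γ →L[ℂ] ell2 Γ)) }
  map_one' := by
    ext1 a
    refine Subtype.ext ?_
    change Unitary.conjStarAlgAut ℂ _ (autUnitary (1 : MulAut Γ)) (a : ell2 Γ →L[ℂ] ell2 Γ) = a
    rw [autUnitary_one, map_one, StarAlgEquiv.one_apply]
  map_mul' S T := by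
    ext1 a
    refine Subtype.ext ?_
    change Unitary.conjStarAlgAut ℂ _ (autUnitary (S * T)) (a : ell2 Γ →L[ℂ] ell2 Γ) =
      Unitary.conjStarAlgAut ℂ _ (autUnitary S) (Unitary.conjStarAlgAut ℂ _ (autUnitary T)
        (a : ell2 Γ →L[ℂ] ell2 Γ))
    rw [autUnitary_mul, Unitary.conjStarAlgAut_mul_apply]

theorem coe_dualAut (T : MulAut Γ) (a : (groupVN Γ).toStarSubalgebra) :
    (dualAut T a : ell2 Γ →L[ℂ] ell2 Γ) =
      (autUnitary T : ell2 Γ →L[ℂ] ell2 Γ) * a * star (autUnitary T : ell2 Γ →L[ℂ] ell2 Γ) := rfl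

variable (Γ) in
/-- The canonical trace `μ(a) = ⟨δ₁, a δ₁⟩` on the group von Neumann algebra. -/
def canonicalTrace : (groupVN Γ).toStarSubalgebra →ₗ[ℂ] ℂ where
  toFun a := inner ℂ (basisVec (1 : Γ)) ((a : ell2 Γ →L[ℂ] ell2 Γ) (basisVec 1))
  map_add' a b := by simp
  map_smul' c a := by simp

theorem canonicalTrace_apply (a : (groupVN Γ).toStarSubalgebra) :
    canonicalTrace Γ a = inner ℂ (basisVec (1 : Γ)) ((a : ell2 Γ →L[ℂ] ell2 Γ) (basisVec 1)) := rfl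

theorem canonicalTrace_star_mul_self (a : (groupVN Γ).toStarSubalgebra) :
    canonicalTrace Γ (star a * a) =
      ((‖(a : ell2 Γ →L[ℂ] ell2 Γ) (basisVec 1)‖ ^ 2 : ℝ) : ℂ) := by
  rw [canonicalTrace_apply]
  change inner ℂ _ ((star (a : ell2 Γ →L[ℂ] ell2 Γ)) ((a : ell2 Γ →L[ℂ] ell2 Γ) _)) = _
  rw [ContinuousLinearMap.star_eq_adjoint, ContinuousLinearMap.adjoint_inner_right,
    inner_self_eq_norm_sq_to_K]
  norm_cast

/-- The vector `δ₁` is separating for the group von Neumann algebra. -/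
theorem groupVN_separating {a : ell2 Γ →L[ℂ] ell2 Γ} (ha : a ∈ groupVN Γ)
    (h : a (basisVec 1) = 0) : a = 0 := by
  classical
  have hr : ∀ g : Γ, (permUnitary (Equiv.mulRight g) : ell2 Γ →L[ℂ] ell2 Γ) ∈
      Set.centralizer (Set.range leftReg ∪ star (Set.range leftReg)) := by
    intro g x hx
    have hx' : x ∈ Set.range (leftReg (Γ := Γ)) := by
      rcases hx with hx | ⟨k, hk⟩
      · exact hx
      · refine ⟨k⁻¹, ?_⟩
        rw [← star_star x, ← hk, leftReg, leftReg, star_permUnitary]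
        congr 2
        ext; simp
    obtain ⟨k, rfl⟩ := hx'
    ext f j
    change f ((k⁻¹ * j) * g⁻¹) = f (k⁻¹ * (j * g⁻¹))
    rw [mul_assoc]
  have hz : ∀ g : Γ, a (basisVec g) = 0 := by
    intro g
    have h1 := DFunLike.congr_fun (mem_generatedVN.1 ha _ (hr g)) (basisVec 1)
    change (permUnitary (Equiv.mulRight g) : ell2 Γ →L[ℂ] ell2 Γ) (a (basisVec 1)) =
      a ((permUnitary (Equiv.mulRight g) : ell2 Γ →L[ℂ] ell2 Γ) (basisVec 1)) at h1
    rw [h, map_zero, permUnitary_basisVec] at h1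
    simpa using h1.symm
  refine lp.ext_continuousLinearMap (by norm_num) fun g => ?_
  ext1
  simpa [basisVec] using hz g

theorem autUnitary_star_basisVec_one (T : Γ ≃* Γ) :
    (star (autUnitary T : ell2 Γ →L[ℂ] ell2 Γ)) (basisVec 1) = basisVec 1 := by
  rw [autUnitary, star_permUnitary, permUnitary_basisVec]
  congr 1
  exact map_one T.symm

/-- The dual system of an automorphism `T` of the discrete group `Γ`: the group von Neumann
algebra with its canonical trace and the action `n ↦ αⁿ` of `ℤ`, where `α(a) = U a U*`. -/
def dualSystem (T : Γ ≃* Γ) : WStarSystem (ell2 Γ) (Multiplicative ℤ) where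
  algebra := groupVN Γ
  action := zpowersHom _ (dualAut T)
  state := canonicalTrace Γ
  state_one := by
    rw [canonicalTrace_apply]
    exact inner_basisVec 1
  state_nonneg a := by
    rw [canonicalTrace_star_mul_self]
    exact Complex.zero_le_real.2 (sq_nonneg _)
  state_faithful a h := by
    rw [canonicalTrace_star_mul_self] at h
    refine Subtype.ext (groupVN_separating a.2 ?_)
    simpa using h
  state_normal := by
    refine ⟨fun n => if n = 0 then basisVec 1 else 0, ?_, fun a => ?_⟩
    · refine summable_of_ne_finset_zero (s := {0}) fun n hn => ?_
      have hn' : n ≠ 0 := by simpa using hn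
      simp [hn']
    · have := hasSum_single (f := fun n : ℕ => inner ℂ (if n = 0 then basisVec (1 : Γ) else 0)
        ((a : ell2 Γ →L[ℂ] ell2 Γ) (if n = 0 then basisVec (1 : Γ) else 0))) 0
        (fun n hn => by rw [if_neg hn]; simp)
      simpa [canonicalTrace_apply] using this
  state_invariant n a := by
    rw [zpowersHom_apply, ← map_zpow]
    generalize (T : MulAut Γ) ^ (Multiplicative.toAdd n) = S
    rw [canonicalTrace_apply, coe_dualAut]
    change inner ℂ _ ((autUnitary S : ell2 Γ →L[ℂ] ell2 Γ) ((a : ell2 Γ →L[ℂ] ell2 Γ)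
      ((star (autUnitary S : ell2 Γ →L[ℂ] ell2 Γ)) (basisVec 1)))) = _
    rw [autUnitary_star_basisVec_one, ← ContinuousLinearMap.adjoint_inner_left,
      ← ContinuousLinearMap.star_eq_adjoint, autUnitary_star_basisVec_one, canonicalTrace_apply]

/-- The subgroup of the elements of `Γ` whose orbit `{Tⁿ g : n ∈ ℤ}` is finite. -/
def finiteOrbitSubgroup (T : Γ ≃* Γ) : Subgroup Γ where
  carrier := {g | (Set.range fun n : ℤ => ((T : MulAut Γ) ^ n) g).Finite}
  one_mem' := by
    refine (Set.finite_singleton (1 : Γ)).subset ?_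
    rintro _ ⟨n, rfl⟩
    simp
  mul_mem' {g h} hg hh := by
    refine (hg.mul hh).subset ?_
    rintro _ ⟨n, rfl⟩
    exact ⟨_, ⟨n, rfl⟩, _, ⟨n, rfl⟩, by simp⟩
  inv_mem' {g} hg := by
    refine hg.inv.subset ?_
    rintro _ ⟨n, rfl⟩
    exact ⟨n, by simp⟩

theorem mem_finiteOrbitSubgroup {T : Γ ≃* Γ} {g : Γ} : g ∈ finiteOrbitSubgroup T ↔
    (Set.range fun n : ℤ => ((T : MulAut Γ) ^ n) g).Finite := Iff.rfl

theorem zpow_mem_finiteOrbitSubgroup {T : Γ ≃* Γ} {g : Γ} (hg : g ∈ finiteOrbitSubgroup T)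
    (m : ℤ) : ((T : MulAut Γ) ^ m) g ∈ finiteOrbitSubgroup T := by
  rw [mem_finiteOrbitSubgroup] at hg ⊢
  refine hg.subset ?_
  rintro _ ⟨n, rfl⟩
  exact ⟨n + m, by simp [zpow_add]⟩

/-- The von Neumann algebra generated by the `l(g)` such that `g` has a finite orbit. -/
def finiteOrbitVN (T : Γ ≃* Γ) : VonNeumannAlgebra (ell2 Γ) :=
  generatedVN (leftReg '' (finiteOrbitSubgroup T : Set Γ))

theorem dualAut_zpow_mem (T : Γ ≃* Γ) (m : ℤ) {a : (groupVN Γ).toStarSubalgebra}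
    (ha : (a : ell2 Γ →L[ℂ] ell2 Γ) ∈ finiteOrbitVN T) :
    ((dualAut T ^ m) a : ell2 Γ →L[ℂ] ell2 Γ) ∈ finiteOrbitVN T := by
  rw [← map_zpow]
  refine conj_mem_generatedVN (Unitary.conjStarAlgAut ℂ _ (autUnitary ((T : MulAut Γ) ^ m))) ?_ ha
  rintro _ ⟨g, hg, rfl⟩
  exact ⟨_, zpow_mem_finiteOrbitSubgroup hg m, (conj_leftReg _ g).symm⟩

/-- The finite orbit factor of the dual system of `T`. -/
def finiteOrbitFactor (T : Γ ≃* Γ) : (dualSystem T).Factor where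
  algebra := finiteOrbitVN T
  le := generatedVN_le fun _ hx =>
    subset_generatedVN _ (Set.image_subset_range _ _ hx)
  invariant n := by
    ext a
    constructor
    · rintro ⟨b, hb, rfl⟩
      exact dualAut_zpow_mem T (Multiplicative.toAdd n) hb
    · intro ha
      refine ⟨(dualSystem T).action n⁻¹ a, ?_, ?_⟩
      · exact dualAut_zpow_mem T (Multiplicative.toAdd n⁻¹) ha
      · rw [← StarAlgEquiv.mul_apply, ← map_mul]
        simp

end Dual

end DualSystems

end

/-!
An operator `a` of the group von Neumann algebra is determined by the vector `f = a δ₁`; the norm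
`‖a‖_μ` is the `ℓ²`-norm of `f`, and the dynamics moves `f` to `f ∘ T⁻ⁿ`. Let `E` be the subgroup
of the elements with finite orbit. Everything reduces to the condition that `f` vanishes
outside `E`.

* `a` belongs to the von Neumann algebra generated by `l(E)` if and only if `f` vanishes outside `E`
  (`apply_basisVec_one_eq_zero`, `mem_generatedVN_of_support`). In one direction, the projection
  onto `ℓ²(E)` commutes with `l(E)`, hence with `a`, and it fixes `δ₁`. In the other one,
  `a = ∑ f(h) l(h)` over `h ∈ E` in the sense of matrix coefficients, so `a` commutes
  with everything that commutes with `l(E)`.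
* If `f` vanishes outside `E`, then `f` is within any `ε` of a finitely supported function that is
  fixed by some `T ^ N`, `N > 0`, so `f ∘ T⁻ⁿ` stays close to one of `N` functions
  (`exists_pos_forall_norm_sub_le`).
* If the orbit of `a` is totally bounded and `f(h) ≠ 0`, then, as `f ∘ T⁻ⁿ` has the value `f(h)` at
  `Tⁿ h`, some member of a finite set of `ℓ²`-functions is at least `|f(h)| / 2` in size at `Tⁿ h`.
  There are only finitely many points where this happens, so the orbit of `h` is finite
  (`mem_finiteOrbitSubgroup_of_isCompact`).
-/

noncomputable section

namespace DualSystems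

/-! ### Square-summable functions and matrix coefficients -/

section Ell2

variable {Γ : Type*}

theorem smul_basisVec_eq_single [DecidableEq Γ] (c : ℂ) (g : Γ) :
    c • basisVec g = (lp.single 2 g c : ell2 Γ) := by
  ext k
  simp [basisVec, Pi.single_apply]

theorem hasSum_smul_basisVec (f : ell2 Γ) : HasSum (fun g => f g • basisVec g) f := by
  classical
  simp_rw [smul_basisVec_eq_single]
  exact lp.hasSum_single (by norm_num) f

/-- The action of a bounded operator on `ℓ²(Γ)` in terms of its matrix coefficients. -/
theorem hasSum_apply (x : ell2 Γ →L[ℂ] ell2 Γ) (f : ell2 Γ) (k : Γ) :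
    HasSum (fun g => f g * x (basisVec g) k) (x f k) := by
  have h := (hasSum_smul_basisVec f).mapL x
  have h' := h.mapL (lp.evalCLM ℂ (fun _ : Γ => ℂ) 2 k)
  simp only [map_smul] at h'
  exact h'

theorem ext_basisVec {x y : ell2 Γ →L[ℂ] ell2 Γ}
    (h : ∀ g k, x (basisVec g) k = y (basisVec g) k) : x = y := by
  ext f k
  refine (hasSum_apply x f k).unique ?_
  simpa only [h] using hasSum_apply y f k

theorem basisVec_apply [DecidableEq Γ] (g k : Γ) :
    basisVec g k = if k = g then (1 : ℂ) else 0 := by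
  simp [basisVec, Pi.single_apply]

theorem finite_setOf_le_norm (f : ell2 Γ) {ε : ℝ} (hε : 0 < ε) : {k | ε ≤ ‖f k‖}.Finite := by
  have hf := (memℓp_gen_iff (by norm_num)).1 (lp.memℓp f)
  have h := hf.tendsto_cofinite_zero.eventually (gt_mem_nhds (show 0 < ε ^ (2 : ℝ) by positivity))
  refine Set.Finite.subset (Filter.eventually_cofinite.1 h) fun k hk => ?_
  simp only [Set.mem_ofPred_eq, not_lt] at hk ⊢
  simpa using Real.rpow_le_rpow hε.le hk zero_le_two

theorem norm_permUnitary_apply (e : Equiv.Perm Γ) (f : ell2 Γ) :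
    ‖(permUnitary e : ell2 Γ →L[ℂ] ell2 Γ) f‖ = ‖f‖ :=
  (permIsometry e).norm_map f

theorem memℓp_indicator (s : Set Γ) (f : ell2 Γ) : Memℓp (s.indicator f : Γ → ℂ) 2 :=
  (lp.memℓp f).mono' fun _ => norm_indicator_le_norm_self _ _

/-- The orthogonal projection of `ℓ²(Γ)` onto `ℓ²(s)`, i.e. multiplication by the indicator
function of `s`. -/
def restrictTo (s : Set Γ) : ell2 Γ →L[ℂ] ell2 Γ :=
  LinearMap.mkContinuous
    { toFun := fun f => ⟨s.indicator f, memℓp_indicator s f⟩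
      map_add' := fun f f' => by ext1; exact Set.indicator_add s _ _
      map_smul' := fun c f => by ext1; exact Set.indicator_const_smul s c _ }
    1 fun f => by
      rw [one_mul]
      refine lp.norm_mono (by norm_num) fun g => ?_
      exact norm_indicator_le_norm_self _ _

theorem restrictTo_apply (s : Set Γ) (f : ell2 Γ) (k : Γ) :
    restrictTo s f k = s.indicator f k := rfl

end Ell2

/-! ### Subalgebras generated by subgroups -/

section Subgroup

variable {Γ : Type*} [Group Γ]

theorem leftReg_basisVec (g h : Γ) : leftReg g (basisVec h) = basisVec (g * h) :=
  permUnitary_basisVec _ _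

theorem star_leftReg (g : Γ) : star (leftReg g) = leftReg g⁻¹ := by
  rw [leftReg, leftReg, star_permUnitary]
  congr 2
  ext; simp

/-- The generators of the algebra of a subgroup already form a self-adjoint set. -/
theorem leftReg_image_union_star (E : Subgroup Γ) :
    leftReg '' (E : Set Γ) ∪ star (leftReg '' (E : Set Γ)) = leftReg '' (E : Set Γ) := by
  refine Set.union_eq_self_of_subset_right ?_
  rintro x ⟨g, hg, hx⟩
  refine ⟨g⁻¹, E.inv_mem hg, ?_⟩
  rw [← star_leftReg, hx, star_star]

/-- An operator of the von Neumann algebra generated by `l(E)` maps `δ₁` to a function supported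
on `E`. -/
theorem apply_basisVec_one_eq_zero {E : Subgroup Γ} {a : ell2 Γ →L[ℂ] ell2 Γ}
    (ha : a ∈ generatedVN (leftReg '' (E : Set Γ))) {h : Γ} (hh : h ∉ E) :
    a (basisVec 1) h = 0 := by
  classical
  have hp : restrictTo (E : Set Γ) ∈ Set.centralizer
      (leftReg '' (E : Set Γ) ∪ star (leftReg '' (E : Set Γ))) := by
    rw [leftReg_image_union_star]
    rintro _ ⟨g, hg, rfl⟩
    ext f k
    change (E : Set Γ).indicator f (g⁻¹ * k) = (E : Set Γ).indicator (leftReg g f) k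
    have hk : g⁻¹ * k ∈ E ↔ k ∈ E := E.mul_mem_cancel_left (E.inv_mem hg)
    by_cases hkE : k ∈ E <;> simp [Set.indicator, hk, hkE, leftReg_apply]
  have h1 : restrictTo (E : Set Γ) (basisVec 1) = basisVec 1 := by
    ext k
    rw [restrictTo_apply]
    refine congrFun (Set.indicator_eq_self.2 fun j hj => ?_) k
    rw [Function.mem_support, basisVec_apply, ne_eq, ite_eq_right_iff, Classical.not_imp] at hj
    exact hj.1 ▸ E.one_mem
  have hc := DFunLike.congr_fun (mem_generatedVN.1 ha _ hp) (basisVec 1)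
  change restrictTo (E : Set Γ) (a (basisVec 1)) = a (restrictTo (E : Set Γ) (basisVec 1)) at hc
  rw [h1] at hc
  rw [← hc, restrictTo_apply]
  exact Set.indicator_of_notMem hh _

/-- The matrix coefficients of an operator of the group von Neumann algebra are constant along
right translations, because the right regular representation commutes with the left one. -/
theorem groupVN_apply_basisVec {a : ell2 Γ →L[ℂ] ell2 Γ} (ha : a ∈ groupVN Γ) (g k : Γ) :
    a (basisVec g) k = a (basisVec 1) (k * g⁻¹) := by
  have hr : (permUnitary (Equiv.mulRight g) : ell2 Γ →L[ℂ] ell2 Γ) ∈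
      Set.centralizer (Set.range leftReg ∪ star (Set.range leftReg)) := by
    have h := leftReg_image_union_star (⊤ : Subgroup Γ)
    rw [Subgroup.coe_top, Set.image_univ] at h
    rw [h]
    rintro _ ⟨j, rfl⟩
    ext f i
    change f ((j⁻¹ * i) * g⁻¹) = f (j⁻¹ * (i * g⁻¹))
    rw [mul_assoc]
  have h1 := DFunLike.congr_fun (mem_generatedVN.1 ha _ hr) (basisVec 1)
  change (permUnitary (Equiv.mulRight g) : ell2 Γ →L[ℂ] ell2 Γ) (a (basisVec 1)) =
    a ((permUnitary (Equiv.mulRight g) : ell2 Γ →L[ℂ] ell2 Γ) (basisVec 1)) at h1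
  rw [permUnitary_basisVec] at h1
  have h2 : basisVec g = basisVec (Equiv.mulRight g (1 : Γ)) := by simp
  rw [h2, ← h1]
  rfl

theorem eq_of_hasSum_of_translate {u v : Γ → ℂ} {y z : ℂ} (hu : HasSum u y) (hv : HasSum v z)
    {g k : Γ} (h : ∀ j, u (j * g) = v (j⁻¹ * k)) : y = z := by
  have hu' := (Equiv.mulRight g).hasSum_iff.2 hu
  have hv' := ((Equiv.inv Γ).trans (Equiv.mulRight k)).hasSum_iff.2 hv
  rw [show u ∘ Equiv.mulRight g = v ∘ (Equiv.inv Γ).trans (Equiv.mulRight k) from funext h] at hu'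
  exact hu'.unique hv'

/-- An operator of the group von Neumann algebra that maps `δ₁` to a function supported on the
subgroup `E` belongs to the von Neumann algebra generated by `l(E)`. -/
theorem mem_generatedVN_of_support {E : Subgroup Γ} {a : ell2 Γ →L[ℂ] ell2 Γ}
    (ha : a ∈ groupVN Γ) (hE : ∀ h ∉ E, a (basisVec 1) h = 0) :
    a ∈ generatedVN (leftReg '' (E : Set Γ)) := by
  rw [mem_generatedVN, leftReg_image_union_star]
  intro x hx
  have hx' : ∀ h ∈ E, ∀ g k, x (basisVec (h * g)) k = x (basisVec g) (h⁻¹ * k) := by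
    intro h hh g k
    have hc := DFunLike.congr_fun (hx _ ⟨h, hh, rfl⟩) (basisVec g)
    change leftReg h (x (basisVec g)) = x (leftReg h (basisVec g)) at hc
    rw [← leftReg_basisVec, ← hc, leftReg_apply]
  refine ext_basisVec fun g k => ?_
  change x (a (basisVec g)) k = a (x (basisVec g)) k
  have h1 := hasSum_apply x (a (basisVec g)) k
  have h2 := hasSum_apply a (x (basisVec g)) k
  -- The two sums agree term by term once both are indexed by the element `h` at which `a δ₁` is
  -- evaluated: only `h ∈ E` contribute, and `x` commutes with `l(h)` for these.
  have e : ∀ h, a (basisVec g) (h * g) * x (basisVec (h * g)) k =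
      x (basisVec g) (h⁻¹ * k) * a (basisVec (h⁻¹ * k)) k := by
    intro h
    rw [groupVN_apply_basisVec ha g, groupVN_apply_basisVec ha (h⁻¹ * k), mul_inv_cancel_right,
      mul_inv_rev, inv_inv, mul_inv_cancel_left]
    by_cases hh : h ∈ E
    · rw [hx' h hh, mul_comm]
    · rw [hE h hh, zero_mul, mul_zero]
  exact eq_of_hasSum_of_translate h1 h2 e

end Subgroup

/-! ### The dynamics on vectors -/

section Dynamics

variable {Γ : Type*} [Group Γ]

theorem autUnitary_zpow_add_apply (T : MulAut Γ) (m n : ℤ) (f : ell2 Γ) :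
    (autUnitary (T ^ (m + n)) : ell2 Γ →L[ℂ] ell2 Γ) f =
      (autUnitary (T ^ m) : ell2 Γ →L[ℂ] ell2 Γ)
        ((autUnitary (T ^ n) : ell2 Γ →L[ℂ] ell2 Γ) f) := by
  rw [zpow_add, autUnitary_mul]
  rfl

theorem action_apply_basisVec_one (T : Γ ≃* Γ) (F : (dualSystem T).Factor)
    (n : Multiplicative ℤ) (a : F.toSystem.algebra.toStarSubalgebra) :
    (F.toSystem.action n a : ell2 Γ →L[ℂ] ell2 Γ) (basisVec 1) =
      (autUnitary ((T : MulAut Γ) ^ n.toAdd) : ell2 Γ →L[ℂ] ell2 Γ)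
        ((a : ell2 Γ →L[ℂ] ell2 Γ) (basisVec 1)) := by
  have key : ∀ b : (groupVN Γ).toStarSubalgebra,
      ((zpowersHom _ (dualAut T) n b : (groupVN Γ).toStarSubalgebra) :
        ell2 Γ →L[ℂ] ell2 Γ) (basisVec 1) =
      (autUnitary ((T : MulAut Γ) ^ n.toAdd) : ell2 Γ →L[ℂ] ell2 Γ)
        ((b : ell2 Γ →L[ℂ] ell2 Γ) (basisVec 1)) := by
    intro b
    rw [zpowersHom_apply, ← map_zpow, coe_dualAut]
    change (autUnitary ((T : MulAut Γ) ^ n.toAdd) : ell2 Γ →L[ℂ] ell2 Γ)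
      ((b : ell2 Γ →L[ℂ] ell2 Γ) ((star (autUnitary ((T : MulAut Γ) ^ n.toAdd) :
        ell2 Γ →L[ℂ] ell2 Γ)) (basisVec 1))) = _
    rw [autUnitary_star_basisVec_one]
  exact key (F.incl a)

theorem stateNorm_toSystem (T : Γ ≃* Γ) (F : (dualSystem T).Factor)
    (a : F.toSystem.algebra.toStarSubalgebra) :
    F.toSystem.stateNorm a = ‖(a : ell2 Γ →L[ℂ] ell2 Γ) (basisVec 1)‖ := by
  have key : ∀ b : (groupVN Γ).toStarSubalgebra, Real.sqrt (canonicalTrace Γ (star b * b)).re =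
      ‖(b : ell2 Γ →L[ℂ] ell2 Γ) (basisVec 1)‖ := by
    intro b
    rw [canonicalTrace_star_mul_self, Complex.ofReal_re, Real.sqrt_sq (norm_nonneg _)]
  exact key (F.incl a)

theorem exists_pos_zpow_apply_eq {T : Γ ≃* Γ} {g : Γ} (hg : g ∈ finiteOrbitSubgroup T) :
    ∃ N : ℤ, 0 < N ∧ ((T : MulAut Γ) ^ N) g = g := by
  rw [mem_finiteOrbitSubgroup] at hg
  obtain ⟨m, n, hmn, h⟩ : ∃ m n : ℤ, m < n ∧ ((T : MulAut Γ) ^ m) g = ((T : MulAut Γ) ^ n) g := by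
    by_contra! hne
    refine Set.infinite_range_of_injective (fun m n h => ?_) hg
    rcases lt_trichotomy m n with hlt | heq | hlt
    · exact absurd h (hne m n hlt)
    · exact heq
    · exact absurd h.symm (hne n m hlt)
  refine ⟨n - m, sub_pos.2 hmn, ?_⟩
  rw [sub_eq_neg_add, zpow_add, MulAut.mul_apply, ← h, ← MulAut.mul_apply, ← zpow_add,
    neg_add_cancel, zpow_zero, MulAut.one_apply]

theorem zpow_mul_apply_eq {T : MulAut Γ} {g : Γ} {N : ℤ} (h : (T ^ N) g = g) (q : ℤ) :
    (T ^ (N * q)) g = g := by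
  rw [zpow_mul]
  have h' : T ^ N ∈ MulAction.stabilizer (MulAut Γ) g := h
  exact zpow_mem h' q

/-- Finitely many elements with finite orbits have a common period. -/
theorem exists_common_period (T : Γ ≃* Γ) (s : Finset Γ) :
    ∃ N : ℤ, 0 < N ∧ ∀ g ∈ s, g ∈ finiteOrbitSubgroup T → ((T : MulAut Γ) ^ N) g = g := by
  classical
  induction s using Finset.induction_on with
  | empty => exact ⟨1, one_pos, by simp⟩
  | insert a s _ ih =>
    obtain ⟨N, hN, h⟩ := ih
    by_cases ha : a ∈ finiteOrbitSubgroup T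
    · obtain ⟨M, hM, h'⟩ := exists_pos_zpow_apply_eq ha
      refine ⟨N * M, mul_pos hN hM, fun g hg hgE => ?_⟩
      rcases Finset.mem_insert.1 hg with rfl | hg
      · rw [mul_comm]
        exact zpow_mul_apply_eq h' N
      · exact zpow_mul_apply_eq (h g hg hgE) M
    · refine ⟨N, hN, fun g hg hgE => ?_⟩
      rcases Finset.mem_insert.1 hg with rfl | hg
      · exact absurd hgE ha
      · exact h g hg hgE

/-- A square-summable function supported on the elements with finite orbits is almost periodic. -/
theorem exists_pos_forall_norm_sub_le {T : Γ ≃* Γ} {f : ell2 Γ}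
    (hf : ∀ h ∉ finiteOrbitSubgroup T, f h = 0) {ε : ℝ} (hε : 0 < ε) :
    ∃ N : ℤ, 0 < N ∧ ∀ n : ℤ,
      ‖(autUnitary ((T : MulAut Γ) ^ n) : ell2 Γ →L[ℂ] ell2 Γ) f -
        (autUnitary ((T : MulAut Γ) ^ (n % N)) : ell2 Γ →L[ℂ] ell2 Γ) f‖ < ε := by
  obtain ⟨s, hs⟩ := ((hasSum_smul_basisVec f).eventually
    (Metric.ball_mem_nhds f (half_pos hε))).exists
  replace hs : ‖∑ g ∈ s, f g • basisVec g - f‖ < ε / 2 := by rwa [← dist_eq_norm]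
  set f' := ∑ g ∈ s, f g • basisVec g with hf'
  obtain ⟨N, hN, hper⟩ := exists_common_period T s
  refine ⟨N, hN, fun n => ?_⟩
  have hfix : (autUnitary ((T : MulAut Γ) ^ (N * (n / N))) : ell2 Γ →L[ℂ] ell2 Γ) f' = f' := by
    rw [hf', map_sum]
    refine Finset.sum_congr rfl fun g hg => ?_
    rw [map_smul]
    by_cases hgE : g ∈ finiteOrbitSubgroup T
    · rw [autUnitary, permUnitary_basisVec]
      congr 2
      exact zpow_mul_apply_eq (hper g hg hgE) _
    · rw [hf g hgE, zero_smul, zero_smul]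
  have heq : (autUnitary ((T : MulAut Γ) ^ n) : ell2 Γ →L[ℂ] ell2 Γ) f' =
      (autUnitary ((T : MulAut Γ) ^ (n % N)) : ell2 Γ →L[ℂ] ell2 Γ) f' := by
    conv_lhs => rw [← Int.emod_add_mul_ediv n N, autUnitary_zpow_add_apply, hfix]
  have hnorm : ∀ m : ℤ, ‖(autUnitary ((T : MulAut Γ) ^ m) : ell2 Γ →L[ℂ] ell2 Γ) (f' - f)‖ <
      ε / 2 := fun m => by
    rw [autUnitary, norm_permUnitary_apply]
    exact hs
  calc _ = ‖(autUnitary ((T : MulAut Γ) ^ (n % N)) : ell2 Γ →L[ℂ] ell2 Γ) (f' - f) -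
        (autUnitary ((T : MulAut Γ) ^ n) : ell2 Γ →L[ℂ] ell2 Γ) (f' - f)‖ := by
        rw [map_sub, map_sub, heq]
        congr 1
        abel
    _ < ε := (norm_sub_le _ _).trans_lt (by linarith [hnorm n, hnorm (n % N)])

/-! ### Compact factors -/

theorem isCompact_finiteOrbitFactor (T : Γ ≃* Γ) :
    (finiteOrbitFactor T).toSystem.IsCompact := by
  intro a ε hε
  have ha : (a : ell2 Γ →L[ℂ] ell2 Γ) ∈ generatedVN (leftReg '' (finiteOrbitSubgroup T : Set Γ)) :=
    a.2
  obtain ⟨N, hN, h⟩ := exists_pos_forall_norm_sub_le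
    (fun h hh => apply_basisVec_one_eq_zero ha (h := h) hh) hε
  refine ⟨(fun r : ℤ => (finiteOrbitFactor T).toSystem.action (Multiplicative.ofAdd r) a) ''
    Set.Ico 0 N, (Set.finite_Ico 0 N).image _, fun n => ⟨_, Set.mem_image_of_mem _
      (show n.toAdd % N ∈ Set.Ico 0 N from
        ⟨Int.emod_nonneg _ hN.ne', Int.emod_lt_of_pos _ hN⟩), ?_⟩⟩
  have h' := h n.toAdd
  refine (stateNorm_toSystem T (finiteOrbitFactor T) _).trans_lt ?_
  change ‖((finiteOrbitFactor T).toSystem.action n a : ell2 Γ →L[ℂ] ell2 Γ) (basisVec 1) -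
    ((finiteOrbitFactor T).toSystem.action (Multiplicative.ofAdd (n.toAdd % N)) a :
      ell2 Γ →L[ℂ] ell2 Γ) (basisVec 1)‖ < ε
  rw [action_apply_basisVec_one, action_apply_basisVec_one]
  exact h'

/-- An element of a compact factor maps `δ₁` to a function supported on the elements with finite
orbits. -/
theorem mem_finiteOrbitSubgroup_of_isCompact {T : Γ ≃* Γ} {F : (dualSystem T).Factor}
    (hF : F.toSystem.IsCompact) (a : F.toSystem.algebra.toStarSubalgebra) {h : Γ}
    (hh : (a : ell2 Γ →L[ℂ] ell2 Γ) (basisVec 1) h ≠ 0) : h ∈ finiteOrbitSubgroup T := by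
  -- The points where some member of a `c / 2`-net is at least `c / 2` in size form a finite set,
  -- which contains the orbit of `h`.
  set c := ‖(a : ell2 Γ →L[ℂ] ell2 Γ) (basisVec 1) h‖ with hc
  have hpos : 0 < c / 2 := half_pos (norm_pos_iff.2 hh)
  obtain ⟨t, ht, hcov⟩ := hF a (c / 2) hpos
  have hfin := ht.biUnion fun b _ =>
    finite_setOf_le_norm ((b : ell2 Γ →L[ℂ] ell2 Γ) (basisVec 1)) hpos
  refine mem_finiteOrbitSubgroup.2 (hfin.subset ?_)
  rintro _ ⟨n, rfl⟩
  obtain ⟨b, hb, hlt⟩ := hcov (Multiplicative.ofAdd n)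
  refine Set.mem_biUnion hb ?_
  replace hlt := (stateNorm_toSystem T F _).symm.trans_lt hlt
  change ‖(F.toSystem.action (Multiplicative.ofAdd n) a : ell2 Γ →L[ℂ] ell2 Γ) (basisVec 1) -
    (b : ell2 Γ →L[ℂ] ell2 Γ) (basisVec 1)‖ < c / 2 at hlt
  rw [action_apply_basisVec_one, toAdd_ofAdd] at hlt
  have hle := (lp.norm_apply_le_norm (by norm_num) _ (((T : MulAut Γ) ^ n) h)).trans_lt hlt
  rw [lp.coeFn_sub, Pi.sub_apply, autUnitary_apply, MulEquiv.symm_apply_apply] at hle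
  have htri := norm_sub_norm_le ((a : ell2 Γ →L[ℂ] ell2 Γ) (basisVec 1) h)
    ((b : ell2 Γ →L[ℂ] ell2 Γ) (basisVec 1) (((T : MulAut Γ) ^ n) h))
  rw [← hc] at htri
  change c / 2 ≤ _
  linarith

theorem le_finiteOrbitFactor_of_isCompact {T : Γ ≃* Γ} {F : (dualSystem T).Factor}
    (hF : F.toSystem.IsCompact) : F ≤ finiteOrbitFactor T := by
  change F.algebra ≤ finiteOrbitVN T
  intro a ha
  refine mem_generatedVN_of_support (F.le ha) fun h hh => ?_
  by_contra hne
  exact hh (mem_finiteOrbitSubgroup_of_isCompact hF ⟨a, ha⟩ hne)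

end Dynamics

end DualSystems

end

theorem proposition3p12 {Γ : Type*} [Group Γ] (T : Γ ≃* Γ) :
    (DualSystems.dualSystem T).IsBiggestCompactFactor (DualSystems.finiteOrbitFactor T) :=
  ⟨DualSystems.isCompact_finiteOrbitFactor T,
    fun _ hF => DualSystems.le_finiteOrbitFactor_of_isCompact hF⟩
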